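/- Let $$f^s(u,v)=\bigl(u,\;u^2f_{21}(u)+v^2+us\,f_{24}(u,s),\;u^2f_{31}(u)+v^2f_{32}(u,v,s)+v f_{33}(u,s)+us\,f_{34}(u,s)\bigr),$$ where $f_{21},f_{31},f_{24},f_{33},f_{34},f_{32}$ are smooth function germs at the origin with $f_{32}(0,0,0)=0$, $f_{33}(0,0)=(f_{33})_u(0,0)=0$ and $f_{33}(0,s)=s$. Write $$f_{33}(u,s)=s+us\,c_1(s)+u^2c_2(s)+u^3c_3(s)+u^4c_4(u,s)$$ with smooth germs $c_1,c_2,c_3,c_4$, and suppose that $c_2(0)=c_{20}^2>0$. Then there is a smooth function germ $u(\tilde s)$ with $u(0)=0$ such that, for $s=-\tilde s^2$ and near the origin, the singular points of $f^s$ (the points where $df^s$ has rank less than $2$) are exactly $(u(\tilde s),0)$ and $(u(-\tilde s),0)$, and $$u(\tilde s)=\frac{1}{c_{20}}\tilde s+\frac{1}{2c_{20}^4}\bigl(c_1(0)c_{20}^2-c_3(0)\bigr)\tilde s^2+\frac{1}{8c_{20}^7}\Bigl(\bigl(c_1(0)^2+4(c_2)_s(0)\bigr)c_{20}^4-2\bigl(3c_3(0)c_1(0)+2c_4(0,0)\bigr)c_{20}^2+5c_3(0)^2\Bigr)\tilde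 s^3+O(\tilde s^4)$$ as $\tilde s\to0$. Moreover, for all sufficiently small $\tilde s\neq0$, the germs of $f^s$, $s=-\tilde s^2$, at $(u(\tilde s),0)$ and at $(u(-\tilde s),0)$ are both Whitney umbrellas, that is, they are equivalent, under smooth coordinate changes of source and target, to the germ of $(u,v)\mapsto(u,uv,v^2)$ at the origin. -/

import Mathlib

open Filter Topology Asymptotics
open scoped ContDiff

namespace S1Deformation

/-- `f` represents a smooth function germ at the origin: it is `C^∞` on a neighbourhood of `0`. -/
def SmoothGerm {E F : Type*} [NormedAddCommGroup E] [NormedSpace ℝ E]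
    [NormedAddCommGroup F] [NormedSpace ℝ F] (f : E → F) : Prop :=
  ∀ᶠ x in 𝓝 (0 : E), ContDiffAt ℝ ∞ f x

/-- A homeomorphism between open sets which is a `C^∞` diffeomorphism
(a local coordinate change). -/
def IsCoordChange {E : Type*} [NormedAddCommGroup E] [NormedSpace ℝ E]
    (φ : OpenPartialHomeomorph E E) : Prop :=
  ContDiffOn ℝ ∞ φ φ.source ∧ ContDiffOn ℝ ∞ φ.symm φ.target

/-- `𝒜`-equivalence of the germ of `f` at `p` and the germ of `g` at `q`:
`g = ψ ∘ f ∘ φ⁻¹` near `q` for coordinate changes `φ`, `ψ` of source and target with `φ p = q`. -/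
def AEquivalent (f : ℝ × ℝ → ℝ × ℝ × ℝ) (p : ℝ × ℝ)
    (g : ℝ × ℝ → ℝ × ℝ × ℝ) (q : ℝ × ℝ) : Prop :=
  ∃ (φ : OpenPartialHomeomorph (ℝ × ℝ) (ℝ × ℝ))
    (ψ : OpenPartialHomeomorph (ℝ × ℝ × ℝ) (ℝ × ℝ × ℝ)),
    IsCoordChange φ ∧ IsCoordChange ψ ∧ p ∈ φ.source ∧ φ p = q ∧
    ∀ᶠ x in 𝓝 p, f x ∈ ψ.source ∧ ψ (f x) = g (φ x)

/-- The germ of `f` at `p` is a Whitney umbrella. -/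
def IsWhitneyUmbrella (f : ℝ × ℝ → ℝ × ℝ × ℝ) (p : ℝ × ℝ) : Prop :=
  AEquivalent f p (fun x => (x.1, x.1 * x.2, x.2 ^ 2)) (0, 0)

/-- `p` is a singular point of (the differentiable map) `f`: `df_p` has rank less than `2`. -/
def IsSingularPoint (f : ℝ × ℝ → ℝ × ℝ × ℝ) (p : ℝ × ℝ) : Prop :=
  ¬ Function.Injective (fderiv ℝ f p)

/-- The family `f^s(u,v) = (u, u² f₂₁(u) + v² + u s f₂₄(u,s),
u² f₃₁(u) + v² f₃₂(u,v,s) + v f₃₃(u,s) + u s f₃₄(u,s))`. -/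
def normalForm (f21 f31 : ℝ → ℝ) (f24 f33 f34 : ℝ × ℝ → ℝ) (f32 : ℝ × ℝ × ℝ → ℝ)
    (s : ℝ) (x : ℝ × ℝ) : ℝ × ℝ × ℝ :=
  (x.1,
    x.1 ^ 2 * f21 x.1 + x.2 ^ 2 + x.1 * s * f24 (x.1, s),
    x.1 ^ 2 * f31 x.1 + x.2 ^ 2 * f32 (x.1, x.2, s) + x.2 * f33 (x.1, s)
      + x.1 * s * f34 (x.1, s))

/-- The conditions on the coefficient germs in the normal form, including `f₃₃(0,s) = s`. -/
structure IsNormalForm (f21 f31 : ℝ → ℝ) (f24 f33 f34 : ℝ × ℝ → ℝ)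
    (f32 : ℝ × ℝ × ℝ → ℝ) : Prop where
  smooth21 : SmoothGerm f21
  smooth31 : SmoothGerm f31
  smooth24 : SmoothGerm f24
  smooth33 : SmoothGerm f33
  smooth34 : SmoothGerm f34
  smooth32 : SmoothGerm f32
  f32_zero : f32 (0, 0, 0) = 0
  f33_zero : f33 (0, 0) = 0
  f33_u_zero : deriv (fun u => f33 (u, 0)) 0 = 0
  f33_s : ∀ᶠ s in 𝓝 (0 : ℝ), f33 (0, s) = s

/-- The smooth germs `c₁, c₂, c₃, c₄` are the coefficients in
`f₃₃(u,s) = s + u s c₁(s) + u² c₂(s) + u³ c₃(s) + u⁴ c₄(u,s)`. -/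
structure IsExpansion (f33 : ℝ × ℝ → ℝ) (c1 c2 c3 : ℝ → ℝ) (c4 : ℝ × ℝ → ℝ) : Prop where
  smooth1 : SmoothGerm c1
  smooth2 : SmoothGerm c2
  smooth3 : SmoothGerm c3
  smooth4 : SmoothGerm c4
  eq : ∀ᶠ x in 𝓝 (0 : ℝ × ℝ),
    f33 x = x.2 + x.1 * x.2 * c1 x.2 + x.1 ^ 2 * c2 x.2 + x.1 ^ 3 * c3 x.2 + x.1 ^ 4 * c4 x

end S1Deformation

/-! Since the first component is `u` and the second has `v`-derivative `2v`, the rank drops exactly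
where `v = 0` and `f₃₃(u, s) = 0`. For `s = -t²`, positivity of `c₂(0)` makes `f₃₃` a difference of
squares `(u a)² - (t b)²` with `a`, `b` even in `t`, so it factors as `h(u, t) h(u, -t)` with `h = u
a - t b`. As `h_u(0) = c₂₀ ≠ 0`, the implicit function theorem gives the smooth root `u(t)`; the
other factor contributes `u(-t)`.

For the expansion, a cubic polynomial that solves `f₃₃ = 0` up to `O(t⁵)` solves `h = 0` up to
`O(t⁴)`, the other factor being of exact order `t`. `exists_implicit_function` bounds the distance
to the root by that residual.

For the umbrellas, the zero of `f₃₃(·, s)` at `u(t)` is simple, because `h(u(t), -t) = 2 t b ≠ 0`.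
Explicit coordinate changes then give the standard form, once the coefficient of `v²` is split as
`α(u, v²) + v β(u, v²)`. This splitting (Whitney) is proved by Fourier inversion: `cos` and `sin y /
y` are smooth functions of `y²`. -/

namespace S1Deformation

/-! ### Cosine as a smooth function of the square, with bounded derivatives -/

section BoundedDerivatives

/-- A function on the line all of whose derivatives, including the zeroth, are bounded. -/
def BoundedDerivs (c : ℝ → ℝ) : Prop :=
  ContDiff ℝ ∞ c ∧ ∀ n : ℕ, ∃ M : ℝ, ∀ y, |iteratedDeriv n c y| ≤ M

theorem BoundedDerivs.deriv {c : ℝ → ℝ} (hc : BoundedDerivs c) : BoundedDerivs (deriv c) := by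
  refine ⟨(contDiff_infty_iff_deriv.1 hc.1).2, fun n => ?_⟩
  obtain ⟨M, hM⟩ := hc.2 (n + 1)
  exact ⟨M, fun y => by rw [← iteratedDeriv_succ']; exact hM y⟩

theorem BoundedDerivs.const_mul {c : ℝ → ℝ} (hc : BoundedDerivs c) (a : ℝ) :
    BoundedDerivs (fun y => a * c y) := by
  refine ⟨contDiff_const.mul hc.1, fun n => ?_⟩
  obtain ⟨M, hM⟩ := hc.2 n
  refine ⟨|a| * M, fun y => ?_⟩
  rw [iteratedDeriv_const_mul_field, abs_mul]
  gcongr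
  exact hM y

theorem BoundedDerivs.exists_bound {c : ℝ → ℝ} (hc : BoundedDerivs c) :
    ∃ M : ℝ, ∀ y, |c y| ≤ M := by
  simpa using hc.2 0

/-- `cos √y` extends to a smooth function on the whole line. -/
theorem exists_contDiff_cos_sqrt : ∃ C : ℝ → ℝ, ContDiff ℝ ∞ C ∧ ∀ y, C (y ^ 2) = Real.cos y := by
  set a : ℕ → ℝ := fun n => (-1) ^ n / (2 * n).factorial with ha
  have hrad : (FormalMultilinearSeries.ofScalars ℝ a).radius = ⊤ := by
    apply FormalMultilinearSeries.ofScalars_radius_eq_top_of_tendsto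
    · exact Eventually.of_forall fun n => by simp [ha, Nat.factorial_ne_zero]
    · have h : ∀ n : ℕ, ‖a n.succ‖ / ‖a n‖ = 1 / ((2 * n + 2 : ℝ) * (2 * n + 1)) := by
        intro n
        have h1 : (2 * n.succ).factorial = (2 * n + 2) * ((2 * n + 1) * (2 * n).factorial) := by
          rw [show 2 * n.succ = (2 * n + 1) + 1 by lia, Nat.factorial_succ, Nat.factorial_succ]
        have h2 : ((2 * n).factorial : ℝ) ≠ 0 := by exact_mod_cast Nat.factorial_ne_zero _
        simp only [ha, norm_div, norm_pow, norm_neg, norm_one, one_pow, RCLike.norm_natCast, h1]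
        push_cast
        field_simp
      simp_rw [h]
      refine squeeze_zero (fun n => by positivity) (fun n => ?_) tendsto_one_div_add_atTop_nhds_zero_nat
      apply one_div_le_one_div_of_le
      · positivity
      · have : (0 : ℝ) ≤ n := n.cast_nonneg
        nlinarith
  refine ⟨FormalMultilinearSeries.ofScalarsSum a, ?_, fun y => ?_⟩
  · have h := (FormalMultilinearSeries.ofScalars ℝ a).hasFPowerSeriesOnBall (by simp [hrad])
    have h2 := h.analyticOnNhd
    rw [hrad] at h2
    have h3 : AnalyticOnNhd ℝ (FormalMultilinearSeries.ofScalarsSum (E := ℝ) a) Set.univ := by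
      intro x _
      exact h2 x (by simp)
    exact contDiffOn_univ.1 h3.contDiffOn_of_completeSpace
  · rw [FormalMultilinearSeries.ofScalarsSum_eq_tsum]
    refine (Real.hasSum_cos y).tsum_eq ▸ tsum_congr fun n => ?_
    simp only [ha, smul_eq_mul, ← pow_mul]
    ring

/-- The point of this form is that it is bounded for `y ≥ 1`, where `(√y)⁻¹` stays in `[0, 1]`. -/
theorem iteratedDeriv_cos_sqrt {C : ℝ → ℝ}
    (hcos : ∀ y, C (y ^ 2) = Real.cos y) (n : ℕ) :
    ∃ p q : Polynomial ℝ, ∀ y, 0 < y → iteratedDeriv n C y =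
      p.eval (√y)⁻¹ * Real.cos √y + q.eval (√y)⁻¹ * Real.sin √y := by
  induction n with
  | zero =>
    refine ⟨1, 0, fun y hy => ?_⟩
    simp [← hcos, Real.sq_sqrt hy.le]
  | succ n ih =>
    obtain ⟨p, q, h⟩ := ih
    -- The derivatives of `(√y)⁻¹` and `√y` are `-(1/2) (√y)⁻³` and `(1/2) (√y)⁻¹`.
    refine ⟨Polynomial.derivative p * (-Polynomial.C (1 / 2) * Polynomial.X ^ 3)
        + q * (Polynomial.C (1 / 2) * Polynomial.X),
      Polynomial.derivative q * (-Polynomial.C (1 / 2) * Polynomial.X ^ 3)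
        - p * (Polynomial.C (1 / 2) * Polynomial.X), fun y hy => ?_⟩
    have hev : iteratedDeriv n C =ᶠ[𝓝 y]
        fun y => p.eval (√y)⁻¹ * Real.cos √y + q.eval (√y)⁻¹ * Real.sin √y := by
      filter_upwards [lt_mem_nhds hy] with z hz using h z hz
    have hs : HasDerivAt Real.sqrt (1 / (2 * √y)) y := Real.hasDerivAt_sqrt hy.ne'
    have hy0 : √y ≠ 0 := (Real.sqrt_pos.2 hy).ne'
    have hi := hs.inv hy0
    have hp := (p.hasDerivAt (√y)⁻¹).comp y hi
    have hq := (q.hasDerivAt (√y)⁻¹).comp y hi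
    have := (hp.mul hs.cos).add (hq.mul hs.sin)
    rw [iteratedDeriv_succ, hev.deriv_eq]
    refine HasDerivAt.deriv (this.congr_deriv ?_)
    simp only [Polynomial.eval_add, Polynomial.eval_sub, Polynomial.eval_mul, Polynomial.eval_neg,
      Polynomial.eval_C, Polynomial.eval_pow, Polynomial.eval_X, Function.comp, Pi.inv_apply]
    field_simp
    ring

/-- A smooth function with bounded derivatives which equals `cos √y` for `y ≥ 0`. -/
theorem exists_boundedDerivs_cos_sqrt :
    ∃ c : ℝ → ℝ, BoundedDerivs c ∧ ∀ y, c (y ^ 2) = Real.cos y := by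
  obtain ⟨C, hC, hcos⟩ := exists_contDiff_cos_sqrt
  -- For `y < 0` the extension is `cosh √|y|`, which is unbounded; the cutoff removes it below `-2`
  -- and changes nothing above `-1`.
  set c : ℝ → ℝ := fun y => Real.smoothTransition (y + 2) * C y with hcdef
  have hc : ContDiff ℝ ∞ c :=
    (Real.smoothTransition.contDiff.comp (contDiff_id.add contDiff_const)).mul hC
  have hcC : ∀ y, -1 ≤ y → c y = C y := fun y hy => by
    simp [hcdef, Real.smoothTransition.one_of_one_le (show 1 ≤ y + 2 by linarith)]
  have hc0 : ∀ y, y ≤ -2 → c y = 0 := fun y hy => by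
    simp [hcdef, Real.smoothTransition.zero_of_nonpos (show y + 2 ≤ 0 by linarith)]
  refine ⟨c, ⟨hc, fun n => ?_⟩, fun y => ?_⟩
  · obtain ⟨p, q, hpq⟩ := iteratedDeriv_cos_sqrt hcos n
    have hcont : Continuous (iteratedDeriv n c) := hc.continuous_iteratedDeriv n (by exact_mod_cast le_top)
    obtain ⟨M₁, h₁⟩ := (isCompact_Icc (a := (-2 : ℝ)) (b := 1)).exists_bound_of_continuousOn
      hcont.continuousOn
    obtain ⟨M₂, h₂⟩ := (isCompact_Icc (a := (0 : ℝ)) (b := 1)).exists_bound_of_continuousOn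
      p.continuous.continuousOn
    obtain ⟨M₃, h₃⟩ := (isCompact_Icc (a := (0 : ℝ)) (b := 1)).exists_bound_of_continuousOn
      q.continuous.continuousOn
    have hM₁ : 0 ≤ M₁ := (norm_nonneg _).trans (h₁ 0 (by norm_num))
    have hM₂ : 0 ≤ M₂ := (norm_nonneg _).trans (h₂ 0 (by norm_num))
    have hM₃ : 0 ≤ M₃ := (norm_nonneg _).trans (h₃ 0 (by norm_num))
    refine ⟨M₁ + (M₂ + M₃), fun y => ?_⟩
    rcases lt_or_ge y (-2) with hy | hy
    · have : c =ᶠ[𝓝 y] fun _ => 0 := by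
        filter_upwards [gt_mem_nhds hy] with z hz using hc0 z hz.le
      rw [this.iteratedDeriv_eq]
      simp only [iteratedDeriv_fun_const_zero, abs_zero]
      positivity
    rcases le_or_gt y 1 with hy1 | hy1
    · exact (h₁ y ⟨hy, hy1⟩).trans (by linarith)
    · have : c =ᶠ[𝓝 y] C := by
        filter_upwards [lt_mem_nhds hy1] with z hz using hcC z (by linarith)
      rw [this.iteratedDeriv_eq, hpq y (by linarith)]
      have hr : (√y)⁻¹ ∈ Set.Icc (0 : ℝ) 1 :=
        ⟨by positivity, inv_le_one_of_one_le₀ (Real.one_le_sqrt.2 hy1.le)⟩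
      refine (abs_add_le _ _).trans ?_
      rw [abs_mul, abs_mul]
      have e₁ := mul_le_mul (h₂ _ hr) (Real.abs_cos_le_one √y) (abs_nonneg _) hM₂
      have e₂ := mul_le_mul (h₃ _ hr) (Real.abs_sin_le_one √y) (abs_nonneg _) hM₃
      simp only [Real.norm_eq_abs] at e₁ e₂
      linarith
  · rw [hcC _ (by nlinarith [sq_nonneg y]), hcos]

/-- Differentiating `c (y²) = cos y` shows that `sin y / y` is a smooth function of `y²` too. -/
theorem mul_deriv_cos_sqrt {c : ℝ → ℝ} (hc : ContDiff ℝ ∞ c) (hcos : ∀ y, c (y ^ 2) = Real.cos y)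
    (y : ℝ) : y * (-2 * deriv c (y ^ 2)) = Real.sin y := by
  have h1 := ((hc.differentiable (by simp)) (y ^ 2)).hasDerivAt.comp y (hasDerivAt_pow 2 y)
  have h2 : (c ∘ fun y : ℝ => y ^ 2) = Real.cos := funext hcos
  rw [h2] at h1
  have := h1.unique (Real.hasDerivAt_cos y)
  simp at this
  linarith

end BoundedDerivatives

/-! ### Smoothness of the kernel integrals -/

section EvenOdd

open MeasureTheory

/-- A measurable function which is integrable against every polynomial weight. -/
def RapidDecay (g : EuclideanSpace ℝ (Fin 2) → ℂ) : Prop :=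
  AEStronglyMeasurable g ∧ ∀ k : ℕ, Integrable fun w => ‖w‖ ^ k * ‖g w‖

theorem RapidDecay.coord_mul {g : EuclideanSpace ℝ (Fin 2) → ℂ} (hg : RapidDecay g) (i : Fin 2) :
    RapidDecay fun w => (w i : ℂ) * g w := by
  have hm : AEStronglyMeasurable (fun w : EuclideanSpace ℝ (Fin 2) => (w i : ℂ)) := by
    apply Continuous.aestronglyMeasurable
    fun_prop
  refine ⟨hm.mul hg.1, fun k => ?_⟩
  refine (hg.2 (k + 1)).mono' ?_ (Eventually.of_forall fun w => ?_)
  · exact (continuous_norm.pow k).aestronglyMeasurable.mul (hm.mul hg.1).norm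
  · have h : ‖w i‖ ≤ ‖w‖ := PiLp.norm_apply_le w i
    rw [Real.norm_of_nonneg (by positivity), norm_mul, Complex.norm_real, pow_succ, mul_assoc]
    gcongr

theorem RapidDecay.const_mul {g : EuclideanSpace ℝ (Fin 2) → ℂ} (hg : RapidDecay g) (a : ℂ) :
    RapidDecay fun w => a * g w := by
  refine ⟨hg.1.const_mul a, fun k => ?_⟩
  refine ((hg.2 k).const_mul ‖a‖).congr (Eventually.of_forall fun w => ?_)
  simp only [norm_mul]
  ring

theorem RapidDecay.integrable {g : EuclideanSpace ℝ (Fin 2) → ℂ} (hg : RapidDecay g) :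
    Integrable g :=
  (integrable_norm_iff hg.1).1 (by simpa using hg.2 0)

/-- The integral of `g` against the kernel `exp(i x₁ w₀) c(x₂ w₁²)`. -/
noncomputable def kernelIntegral (g : EuclideanSpace ℝ (Fin 2) → ℂ) (c : ℝ → ℝ) (x : ℝ × ℝ) : ℂ :=
  ∫ w, g w * (Complex.exp ((x.1 * w 0 : ℝ) * Complex.I) * (c (x.2 * w 1 ^ 2) : ℂ))

theorem aestronglyMeasurable_kernel {g : EuclideanSpace ℝ (Fin 2) → ℂ} {c : ℝ → ℝ}
    (hg : RapidDecay g) (hc : Continuous c) (x : ℝ × ℝ) :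
    AEStronglyMeasurable fun w =>
      g w * (Complex.exp ((x.1 * w 0 : ℝ) * Complex.I) * (c (x.2 * w 1 ^ 2) : ℂ)) := by
  refine hg.1.mul (Continuous.aestronglyMeasurable ?_)
  fun_prop

theorem norm_kernel_le {c : ℝ → ℝ} {M : ℝ} (hM : ∀ y, |c y| ≤ M) (z : ℂ) (a b : ℝ) :
    ‖z * (Complex.exp ((a : ℝ) * Complex.I) * (c b : ℂ))‖ ≤ M * ‖z‖ := by
  rw [norm_mul, norm_mul, Complex.norm_exp_ofReal_mul_I, one_mul, Complex.norm_real, mul_comm]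
  gcongr
  exact hM b

theorem integrable_kernel {g : EuclideanSpace ℝ (Fin 2) → ℂ} {c : ℝ → ℝ}
    (hg : RapidDecay g) (hc : BoundedDerivs c) (x : ℝ × ℝ) :
    Integrable fun w =>
      g w * (Complex.exp ((x.1 * w 0 : ℝ) * Complex.I) * (c (x.2 * w 1 ^ 2) : ℂ)) := by
  obtain ⟨M, hM⟩ := hc.exists_bound
  exact (hg.integrable.norm.const_mul M).mono' (aestronglyMeasurable_kernel hg hc.1.continuous x)
    (Eventually.of_forall fun w => norm_kernel_le hM _ _ _)

theorem hasFDerivAt_kernel {c : ℝ → ℝ} (hc : Differentiable ℝ c) (z : ℂ) (a b : ℝ) (x : ℝ × ℝ) :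
    HasFDerivAt (fun x : ℝ × ℝ =>
        z * (Complex.exp ((x.1 * a : ℝ) * Complex.I) * (c (x.2 * b ^ 2) : ℂ)))
      ((ContinuousLinearMap.fst ℝ ℝ ℝ).smulRight
          (Complex.I * (a * z) * (Complex.exp ((x.1 * a : ℝ) * Complex.I) * (c (x.2 * b ^ 2) : ℂ)))
        + (ContinuousLinearMap.snd ℝ ℝ ℝ).smulRight
          (b * (b * z) * (Complex.exp ((x.1 * a : ℝ) * Complex.I) *
            ((deriv c (x.2 * b ^ 2) : ℝ) : ℂ)))) x := by
  have h1 : HasFDerivAt (fun x : ℝ × ℝ => ((x.1 * a : ℝ) : ℂ) * Complex.I)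
      ((ContinuousLinearMap.fst ℝ ℝ ℝ).smulRight (a * Complex.I)) x := by
    have : (fun x : ℝ × ℝ => ((x.1 * a : ℝ) : ℂ) * Complex.I) =
        ((ContinuousLinearMap.fst ℝ ℝ ℝ).smulRight (a * Complex.I)) := by
      ext x
      simp [mul_assoc]
    rw [this]
    exact ContinuousLinearMap.hasFDerivAt _
  have h2 : HasFDerivAt (fun x : ℝ × ℝ => (c (x.2 * b ^ 2) : ℂ))
      ((ContinuousLinearMap.snd ℝ ℝ ℝ).smulRight ((b ^ 2 * deriv c (x.2 * b ^ 2) : ℝ) : ℂ)) x := by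
    have h3 : HasFDerivAt (fun x : ℝ × ℝ => x.2 * b ^ 2)
        ((b ^ 2) • ContinuousLinearMap.snd ℝ ℝ ℝ) x :=
      hasFDerivAt_snd.mul_const (b ^ 2)
    have h4 := (hc (x.2 * b ^ 2)).hasDerivAt.comp_hasFDerivAt x h3
    have h5 := Complex.ofRealCLM.hasFDerivAt.comp x h4
    refine h5.congr_fderiv ?_
    ext <;> simp
    ring
  refine ((h1.cexp.mul h2).const_mul z).congr_fderiv ?_
  ext <;> simp <;> ring

/-- Differentiation under the integral sign. Both partial derivatives are again kernel integrals,
with coordinates absorbed into `g` and possibly `deriv c` for `c`, so the argument can be iterated.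
-/
theorem hasFDerivAt_kernelIntegral {g : EuclideanSpace ℝ (Fin 2) → ℂ} {c : ℝ → ℝ}
    (hg : RapidDecay g) (hc : BoundedDerivs c) (x : ℝ × ℝ) :
    HasFDerivAt (kernelIntegral g c)
      ((ContinuousLinearMap.fst ℝ ℝ ℝ).smulRight
          (kernelIntegral (fun w => Complex.I * ((w 0 : ℂ) * g w)) c x)
        + (ContinuousLinearMap.snd ℝ ℝ ℝ).smulRight
          (kernelIntegral (fun w => (w 1 : ℂ) * ((w 1 : ℂ) * g w)) (deriv c) x)) x := by
  have hg0 := (hg.coord_mul 0).const_mul Complex.I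
  have hg1 := (hg.coord_mul 1).coord_mul 1
  obtain ⟨M, hM⟩ := hc.exists_bound
  obtain ⟨M', hM'⟩ := hc.deriv.exists_bound
  have hi0 := integrable_kernel hg0 hc x
  have hi1 := integrable_kernel hg1 hc.deriv x
  have hj0 : Integrable fun w => (ContinuousLinearMap.fst ℝ ℝ ℝ).smulRight
      (Complex.I * ((w 0 : ℂ) * g w) *
        (Complex.exp ((x.1 * w 0 : ℝ) * Complex.I) * (c (x.2 * w 1 ^ 2) : ℂ))) :=
    (ContinuousLinearMap.smulRightL ℝ (ℝ × ℝ) ℂ (ContinuousLinearMap.fst ℝ ℝ ℝ)).integrable_comp hi0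
  have hj1 : Integrable fun w => (ContinuousLinearMap.snd ℝ ℝ ℝ).smulRight
      ((w 1 : ℂ) * ((w 1 : ℂ) * g w) *
        (Complex.exp ((x.1 * w 0 : ℝ) * Complex.I) * ((deriv c (x.2 * w 1 ^ 2) : ℝ) : ℂ))) :=
    (ContinuousLinearMap.smulRightL ℝ (ℝ × ℝ) ℂ (ContinuousLinearMap.snd ℝ ℝ ℝ)).integrable_comp hi1
  have hm := hj0.aestronglyMeasurable.add hj1.aestronglyMeasurable
  have key := hasFDerivAt_integral_of_dominated_of_fderiv_le (μ := volume)
    (F := fun (x : ℝ × ℝ) (w : EuclideanSpace ℝ (Fin 2)) =>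
      g w * (Complex.exp ((x.1 * w 0 : ℝ) * Complex.I) * (c (x.2 * w 1 ^ 2) : ℂ)))
    (bound := fun w => M * ‖Complex.I * ((w 0 : ℂ) * g w)‖ + M' * ‖(w 1 : ℂ) * ((w 1 : ℂ) * g w)‖)
    (x₀ := x) univ_mem
    (Eventually.of_forall fun x => aestronglyMeasurable_kernel hg hc.1.continuous x)
    (integrable_kernel hg hc x) hm
    (Eventually.of_forall fun w x _ => ?_)
    ((hg0.integrable.norm.const_mul M).add (hg1.integrable.norm.const_mul M'))
    (Eventually.of_forall fun w x _ =>
      hasFDerivAt_kernel (hc.1.differentiable (by simp)) (g w) (w 0) (w 1) x)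
  · refine key.congr_fderiv ?_
    have e := integral_add hj0 hj1
    refine e.trans (congrArg₂ (· + ·) ?_ ?_)
    · exact ContinuousLinearMap.integral_comp_comm
        (ContinuousLinearMap.smulRightL ℝ (ℝ × ℝ) ℂ (ContinuousLinearMap.fst ℝ ℝ ℝ)) hi0
    · exact ContinuousLinearMap.integral_comp_comm
        (ContinuousLinearMap.smulRightL ℝ (ℝ × ℝ) ℂ (ContinuousLinearMap.snd ℝ ℝ ℝ)) hi1
  · refine (norm_add_le _ _).trans (add_le_add ?_ ?_)
    · rw [ContinuousLinearMap.norm_smulRight_apply]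
      have := norm_kernel_le hM (Complex.I * ((w 0 : ℂ) * g w)) (x.1 * w 0) (x.2 * w 1 ^ 2)
      exact (mul_le_of_le_one_left (norm_nonneg _) (ContinuousLinearMap.norm_fst_le ℝ ℝ ℝ)).trans this
    · rw [ContinuousLinearMap.norm_smulRight_apply]
      have := norm_kernel_le hM' ((w 1 : ℂ) * ((w 1 : ℂ) * g w)) (x.1 * w 0) (x.2 * w 1 ^ 2)
      exact (mul_le_of_le_one_left (norm_nonneg _) (ContinuousLinearMap.norm_snd_le ℝ ℝ ℝ)).trans this

theorem contDiff_kernelIntegral {g : EuclideanSpace ℝ (Fin 2) → ℂ} {c : ℝ → ℝ}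
    (hg : RapidDecay g) (hc : BoundedDerivs c) : ContDiff ℝ ∞ (kernelIntegral g c) := by
  rw [contDiff_infty]
  intro n
  induction n generalizing g c with
  | zero =>
    exact contDiff_zero.2 (continuous_iff_continuousAt.2 fun x =>
      (hasFDerivAt_kernelIntegral hg hc x).continuousAt)
  | succ n ih =>
    refine contDiff_succ_iff_hasFDerivAt.2 ⟨_, ?_, hasFDerivAt_kernelIntegral hg hc⟩
    exact (contDiff_const.smulRight (ih ((hg.coord_mul 0).const_mul Complex.I) hc)).add
      (contDiff_const.smulRight (ih ((hg.coord_mul 1).coord_mul 1) hc.deriv))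

end EvenOdd

/-! ### Whitney's even-odd decomposition by Fourier inversion -/

section EvenOddDecomposition

open MeasureTheory

open FourierTransform SchwartzMap in
theorem exists_rapidDecay_inversion {F : ℝ × ℝ → ℝ} (hF : ContDiff ℝ ∞ F)
    (hs : HasCompactSupport F) : ∃ g, RapidDecay g ∧ ∀ x : ℝ × ℝ, (F x : ℂ) =
      ∫ w, g w * Complex.exp ((2 * Real.pi * (w 0 * x.1 + w 1 * x.2) : ℝ) * Complex.I) := by
  -- The product carries the sup norm, while the Fourier transform needs an inner product.
  let e : EuclideanSpace ℝ (Fin 2) ≃L[ℝ] ℝ × ℝ :=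
    (EuclideanSpace.equiv (Fin 2) ℝ).trans (ContinuousLinearEquiv.finTwoArrow ℝ ℝ)
  have h1 : HasCompactSupport fun v => (F (e v) : ℂ) :=
    (hs.comp_homeomorph e.toHomeomorph).comp_left (g := fun r : ℝ => (r : ℂ)) Complex.ofReal_zero
  have h2 : ContDiff ℝ ∞ fun v => (F (e v) : ℂ) :=
    Complex.ofRealCLM.contDiff.comp (hF.comp e.contDiff)
  let G : 𝓢(EuclideanSpace ℝ (Fin 2), ℂ) := h1.toSchwartzMap h2
  let H : 𝓢(EuclideanSpace ℝ (Fin 2), ℂ) := 𝓕 G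
  refine ⟨H, ⟨H.continuous.aestronglyMeasurable, fun k => H.integrable_pow_mul volume k⟩,
    fun x => ?_⟩
  have h3 : 𝓕⁻ H = G := FourierTransform.fourierInv_fourier_eq G
  have h4 : (F x : ℂ) = G (e.symm x) := by
    simp only [G, HasCompactSupport.toSchwartzMap_toFun, ContinuousLinearEquiv.apply_symm_apply]
  rw [h4, ← h3, SchwartzMap.fourierInv_coe, Real.fourierInv_eq']
  have h5 : ∀ w : EuclideanSpace ℝ (Fin 2), inner ℝ w (e.symm x) = w 0 * x.1 + w 1 * x.2 := by
    intro w
    simp [PiLp.inner_apply, Fin.sum_univ_two, e]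
    ring
  refine integral_congr_ae (Eventually.of_forall fun w => ?_)
  simp only [h5, smul_eq_mul]
  exact mul_comm _ _

/-- In the inversion formula `exp(iθ)` with `θ = 2π v w₁` equals `c(θ²) + iθ s(θ²)`, and `θ²`
depends on `v` only through `v²`. Replacing `v²` by a free variable defines `α` and `β`; the factor
`2πi w₁` left over from `iθ` goes into the weight. -/
theorem exists_even_odd_of_hasCompactSupport {F : ℝ × ℝ → ℝ} (hF : ContDiff ℝ ∞ F)
    (hs : HasCompactSupport F) : ∃ α β : ℝ × ℝ → ℝ, ContDiff ℝ ∞ α ∧ ContDiff ℝ ∞ β ∧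
      ∀ u v, F (u, v) = α (u, v ^ 2) + v * β (u, v ^ 2) := by
  obtain ⟨g, hg, hinv⟩ := exists_rapidDecay_inversion hF hs
  obtain ⟨c, hc, hcos⟩ := exists_boundedDerivs_cos_sqrt
  obtain ⟨s, hsb, hsin⟩ : ∃ s, BoundedDerivs s ∧ ∀ y, y * s (y ^ 2) = Real.sin y :=
    ⟨_, hc.deriv.const_mul (-2), mul_deriv_cos_sqrt hc.1 hcos⟩
  have hg1 := (hg.coord_mul 1).const_mul (2 * Real.pi * Complex.I)
  have hscale : ContDiff ℝ ∞ fun x : ℝ × ℝ => (2 * Real.pi * x.1, (2 * Real.pi) ^ 2 * x.2) := by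
    fun_prop
  refine ⟨fun x => (kernelIntegral g c (2 * Real.pi * x.1, (2 * Real.pi) ^ 2 * x.2)).re,
    fun x => (kernelIntegral (fun w => 2 * Real.pi * Complex.I * ((w 1 : ℂ) * g w)) s
      (2 * Real.pi * x.1, (2 * Real.pi) ^ 2 * x.2)).re, ?_, ?_, fun u v => ?_⟩
  · exact Complex.reCLM.contDiff.comp ((contDiff_kernelIntegral hg hc).comp hscale)
  · exact Complex.reCLM.contDiff.comp ((contDiff_kernelIntegral hg1 hsb).comp hscale)
  · have h : (F (u, v) : ℂ) = kernelIntegral g c (2 * Real.pi * u, (2 * Real.pi) ^ 2 * v ^ 2)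
        + v * kernelIntegral (fun w => 2 * Real.pi * Complex.I * ((w 1 : ℂ) * g w)) s
          (2 * Real.pi * u, (2 * Real.pi) ^ 2 * v ^ 2) := by
      rw [hinv, kernelIntegral, kernelIntegral, ← integral_const_mul, ← integral_add
        (integrable_kernel hg hc _) ((integrable_kernel hg1 hsb _).const_mul _)]
      refine integral_congr_ae (Eventually.of_forall fun w => ?_)
      simp only
      have e1 : (2 * Real.pi) ^ 2 * v ^ 2 * w 1 ^ 2 = (2 * Real.pi * v * w 1) ^ 2 := by ring
      rw [e1, hcos]
      have e2 : Complex.exp ((2 * Real.pi * (w 0 * u + w 1 * v) : ℝ) * Complex.I) =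
          Complex.exp ((2 * Real.pi * u * w 0 : ℝ) * Complex.I) *
            ((Real.cos (2 * Real.pi * v * w 1) : ℂ)
              + (Real.sin (2 * Real.pi * v * w 1) : ℂ) * Complex.I) := by
        rw [Complex.ofReal_cos, Complex.ofReal_sin, ← Complex.exp_mul_I, ← Complex.exp_add]
        congr 1
        push_cast
        ring
      rw [e2, ← hsin (2 * Real.pi * v * w 1)]
      push_cast
      ring
    have h' := congrArg Complex.re h
    simpa using h'

/-- **Whitney's theorem on even functions**, with a parameter: near `(u₀, 0)` a smooth function of
`(u, v)` is the sum of a smooth function of `(u, v²)` and `v` times such a function. -/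
theorem exists_even_odd {F : ℝ × ℝ → ℝ} {u₀ : ℝ}
    (hF : ∀ᶠ x in 𝓝 (u₀, (0 : ℝ)), ContDiffAt ℝ ∞ F x) :
    ∃ α β : ℝ × ℝ → ℝ, ContDiff ℝ ∞ α ∧ ContDiff ℝ ∞ β ∧
      ∀ᶠ x in 𝓝 (u₀, (0 : ℝ)), F x = α (x.1, x.2 ^ 2) + x.2 * β (x.1, x.2 ^ 2) := by
  obtain ⟨r, hr, hball⟩ := Metric.eventually_nhds_iff_ball.1 hF
  -- Multiplying by a bump function reduces to compact support without changing the germ.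
  let b : ContDiffBump (u₀, (0 : ℝ)) := ⟨r / 4, r / 2, by positivity, by linarith⟩
  have hsm : ContDiff ℝ ∞ fun x => b x * F x := by
    rw [contDiff_iff_contDiffAt]
    intro x
    by_cases hx : x ∈ Metric.ball (u₀, (0 : ℝ)) r
    · exact b.contDiff.contDiffAt.mul (hball x hx)
    · have hx' : x ∉ tsupport b := by
        rw [b.tsupport_eq, Metric.mem_closedBall]
        rw [Metric.mem_ball] at hx
        have : b.rOut = r / 2 := rfl
        intro h
        linarith
      refine (contDiffAt_const (c := (0 : ℝ))).congr_of_eventuallyEq ?_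
      filter_upwards [notMem_tsupport_iff_eventuallyEq.1 hx'] with y hy
      simp [hy]
  obtain ⟨α, β, hα, hβ, h⟩ := exists_even_odd_of_hasCompactSupport hsm b.hasCompactSupport.mul_right
  refine ⟨α, β, hα, hβ, ?_⟩
  filter_upwards [b.eventuallyEq_one] with x hx
  rw [← h x.1 x.2]
  simp [hx]

end EvenOddDecomposition

/-! ### Inverse and implicit functions -/

section CoordinateChanges

/-- The inverse function theorem: a smooth map with injective differential at `a` restricts to a
coordinate change near `a`. -/
theorem exists_isCoordChange {E : Type*} [NormedAddCommGroup E] [NormedSpace ℝ E]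
    [FiniteDimensional ℝ E] {f : E → E} {a : E} (hf : ∀ᶠ x in 𝓝 a, ContDiffAt ℝ ∞ f x)
    (hinj : ∀ y, fderiv ℝ f a y = 0 → y = 0) :
    ∃ φ : OpenPartialHomeomorph E E, IsCoordChange φ ∧ a ∈ φ.source ∧ ⇑φ = f := by
  have : CompleteSpace E := FiniteDimensional.complete ℝ E
  have hfa : ContDiffAt ℝ ∞ f a := hf.self_of_nhds
  have hd : HasFDerivAt f (fderiv ℝ f a) a := (hfa.differentiableAt (by simp)).hasFDerivAt
  have hker : LinearMap.ker (fderiv ℝ f a : E →ₗ[ℝ] E) = ⊥ :=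
    LinearMap.ker_eq_bot'.2 hinj
  let f' : E ≃L[ℝ] E :=
    (LinearEquiv.ofInjectiveEndo (fderiv ℝ f a : E →ₗ[ℝ] E)
      (LinearMap.ker_eq_bot.1 hker)).toContinuousLinearEquiv
  have hf' : HasFDerivAt f (f' : E →L[ℝ] E) a := by
    refine hd.congr_fderiv ?_
    ext x
    simp [f']
  -- Invertibility near `a`, not just at `a`, is what makes the inverse smooth on the whole target
  -- after restriction.
  have hopen : ∀ᶠ x in 𝓝 a, ∃ e : E ≃L[ℝ] E, (e : E →L[ℝ] E) = fderiv ℝ f x := by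
    have hcont : ContinuousAt (fderiv ℝ f) a :=
      (hfa.fderiv_right (m := 0) (by simp)).continuousAt
    exact hcont.eventually (by rw [hf'.fderiv]; exact f'.nhds)
  obtain ⟨U, hU, hUo, haU⟩ := eventually_nhds_iff.1 (hf.and hopen)
  let φ₀ := hfa.toOpenPartialHomeomorph f hf' (by simp)
  have ha₀ : a ∈ φ₀.source := hfa.mem_toOpenPartialHomeomorph_source hf' (by simp)
  refine ⟨φ₀.restrOpen U hUo, ⟨fun x hx => ?_, fun y hy => ?_⟩, ⟨ha₀, haU⟩, rfl⟩
  · exact (hU x hx.2).1.contDiffWithinAt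
  · have hx := (φ₀.restrOpen U hUo).map_target hy
    obtain ⟨h1, e, he⟩ := hU _ hx.2
    refine ((φ₀.restrOpen U hUo).contDiffAt_symm hy (f₀' := e) ?_ h1).contDiffWithinAt
    rw [he]
    exact (h1.differentiableAt (by simp)).hasFDerivAt

/-- The implicit function theorem for a scalar equation `h(x, t) = 0`, together with the estimate
of the distance to the solution by the residual. -/
theorem exists_implicit_function {h : ℝ × ℝ → ℝ} (hh : SmoothGerm h) (h0 : h 0 = 0)
    (hx : fderiv ℝ h 0 (1, 0) ≠ 0) :
    ∃ u : ℝ → ℝ, SmoothGerm u ∧ u 0 = 0 ∧ (∀ᶠ z in 𝓝 (0 : ℝ × ℝ), h z = 0 ↔ z.1 = u z.2) ∧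
      ∃ C : ℝ, ∀ᶠ z in 𝓝 (0 : ℝ × ℝ), |z.1 - u z.2| ≤ C * |h z| := by
  -- Invert `(x, t) ↦ (h(x, t), t)`; the solution is the first coordinate of the preimage of `(0,
  -- t)`.
  have hsm : ∀ᶠ z in 𝓝 (0 : ℝ × ℝ), ContDiffAt ℝ ∞ (fun z : ℝ × ℝ => (h z, z.2)) z := by
    filter_upwards [hh] with z hz using hz.prodMk contDiffAt_snd
  obtain ⟨φ, ⟨-, hφ⟩, h0s, hφeq⟩ := exists_isCoordChange hsm fun y hy => by
    have hd : HasFDerivAt h (fderiv ℝ h 0) 0 :=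
      (hh.self_of_nhds.differentiableAt (by simp)).hasFDerivAt
    rw [(hd.prodMk hasFDerivAt_snd).fderiv] at hy
    obtain ⟨y1, y2⟩ := y
    simp only [ContinuousLinearMap.prod_apply, ContinuousLinearMap.coe_snd', Prod.mk_eq_zero] at hy
    obtain ⟨e1, rfl⟩ := hy
    have e2 : ((y1, 0) : ℝ × ℝ) = y1 • (1, 0) := by simp
    rw [e2, map_smul, smul_eq_mul] at e1
    simpa [hx] using e1
  have hφ0 : φ 0 = 0 := by simp [hφeq, h0]
  have h0t : (0 : ℝ × ℝ) ∈ φ.target := hφ0 ▸ φ.map_source h0s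
  have hsymm0 : φ.symm 0 = 0 := by simpa only [hφ0] using φ.left_inv h0s
  have htar : ∀ᶠ z in 𝓝 (0 : ℝ × ℝ), z ∈ φ.target := φ.open_target.mem_nhds h0t
  have hline : Tendsto (fun t : ℝ => ((0 : ℝ), t)) (𝓝 0) (𝓝 0) :=
    (by fun_prop : Continuous fun t : ℝ => ((0 : ℝ), t)).tendsto 0
  have hCD : ∀ z ∈ φ.target, ContDiffAt ℝ ∞ φ.symm z := fun z hz =>
    hφ.contDiffAt (φ.open_target.mem_nhds hz)
  have hsnd : ∀ z ∈ φ.target, (φ.symm z).2 = z.2 := fun z hz => by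
    have := congrArg Prod.snd (φ.right_inv hz)
    simpa [hφeq] using this
  have hproj : Tendsto (fun z : ℝ × ℝ => z.2) (𝓝 0) (𝓝 0) := continuous_snd.tendsto 0
  -- The local inverse is Lipschitz, and `φ z` lies at distance `|h z|` from `(0, z.2)`.
  have hlip : ∃ C : ℝ, ∀ᶠ z in 𝓝 (0 : ℝ × ℝ), |z.1 - (φ.symm (0, z.2)).1| ≤ C * |h z| := by
    obtain ⟨K, t, ht, hK⟩ := ((hCD 0 h0t).of_le (m := 1) (by simp)).exists_lipschitzOnWith
    refine ⟨K, ?_⟩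
    have hφt : Tendsto φ (𝓝 0) (𝓝 0) := by
      have := φ.continuousAt h0s
      rwa [ContinuousAt, hφ0] at this
    filter_upwards [φ.open_source.mem_nhds h0s, hφt ht, hproj.eventually (hline ht)]
      with z hz hz1 hz2
    have h3 := hK.dist_le_mul _ hz1 _ hz2
    rw [φ.left_inv hz] at h3
    have h4 : dist (φ z) (0, z.2) = |h z| := by
      simp [hφeq, Prod.dist_eq]
    rw [h4, Prod.dist_eq] at h3
    exact (le_max_left _ _).trans h3
  refine ⟨fun t => (φ.symm (0, t)).1, ?_, ?_, ?_, hlip⟩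
  · filter_upwards [hline.eventually htar] with t ht
    exact contDiffAt_fst.comp t ((hCD _ ht).comp t (contDiffAt_const.prodMk contDiffAt_id))
  · exact congrArg Prod.fst hsymm0
  · obtain ⟨C, hC⟩ := hlip
    filter_upwards [hC, hproj.eventually (hline.eventually htar)] with z hz hz2
    constructor
    · intro hzero
      rw [hzero, abs_zero, mul_zero] at hz
      exact sub_eq_zero.1 (abs_nonpos_iff.1 hz)
    · intro heq
      have h5 : z = φ.symm (0, z.2) := Prod.ext heq (hsnd _ hz2).symm
      have h6 := φ.right_inv hz2
      rw [← h5, hφeq] at h6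
      exact congrArg Prod.fst h6

end CoordinateChanges

/-! ### Recognition of Whitney umbrellas -/

section WhitneyUmbrella

/-- With `k = α(u, v²) + v β(u, v²)`, the third component is `B + v² α + v (m + v² β)`. The target
change removes `A`, `B` and `v² α`, all functions of the first two target coordinates, and `m + v²
β` becomes the new first coordinate of source and target; the simple zero of `m` makes both changes
invertible. -/
theorem isWhitneyUmbrella_of_normal {A B m : ℝ → ℝ} {k : ℝ × ℝ → ℝ} {f : ℝ × ℝ → ℝ × ℝ × ℝ} {u₀ : ℝ}
    (hA : ∀ᶠ u in 𝓝 u₀, ContDiffAt ℝ ∞ A u) (hB : ∀ᶠ u in 𝓝 u₀, ContDiffAt ℝ ∞ B u)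
    (hm : ∀ᶠ u in 𝓝 u₀, ContDiffAt ℝ ∞ m u)
    (hk : ∀ᶠ x in 𝓝 (u₀, (0 : ℝ)), ContDiffAt ℝ ∞ k x)
    (hm0 : m u₀ = 0) (hm1 : deriv m u₀ ≠ 0)
    (hf : ∀ x, f x = (x.1, A x.1 + x.2 ^ 2, B x.1 + x.2 ^ 2 * k x + x.2 * m x.1)) :
    IsWhitneyUmbrella f (u₀, 0) := by
  obtain ⟨α, β, hα, hβ, hαβ⟩ := exists_even_odd hk
  have hβd : Differentiable ℝ β := hβ.differentiable (by simp)
  have hαd : Differentiable ℝ α := hα.differentiable (by simp)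
  have hmd : HasDerivAt m (deriv m u₀) u₀ :=
    (hm.self_of_nhds.differentiableAt (by simp)).hasDerivAt
  have hAd : HasDerivAt A (deriv A u₀) u₀ :=
    (hA.self_of_nhds.differentiableAt (by simp)).hasDerivAt
  have hBd : HasDerivAt B (deriv B u₀) u₀ :=
    (hB.self_of_nhds.differentiableAt (by simp)).hasDerivAt
  obtain ⟨φ, hφ, hφs, hφe⟩ := exists_isCoordChange
    (f := fun x : ℝ × ℝ => (m x.1 + x.2 ^ 2 * β (x.1, x.2 ^ 2), x.2)) (a := (u₀, 0))
    (by
      have hfst : Tendsto (fun x : ℝ × ℝ => x.1) (𝓝 (u₀, 0)) (𝓝 u₀) := continuousAt_fst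
      filter_upwards [hfst.eventually hm] with x hx
      have h1 : ContDiffAt ℝ ∞ (fun x : ℝ × ℝ => m x.1) x := hx.comp x contDiffAt_fst
      have h2 : ContDiffAt ℝ ∞ (fun x : ℝ × ℝ => x.2 ^ 2 * β (x.1, x.2 ^ 2)) x := by fun_prop
      exact (h1.add h2).prodMk contDiffAt_snd)
    (by
      intro y hy
      have h1 : HasFDerivAt (fun x : ℝ × ℝ => m x.1)
          (deriv m u₀ • ContinuousLinearMap.fst ℝ ℝ ℝ) (u₀, 0) :=
        hmd.comp_hasFDerivAt (u₀, (0 : ℝ)) hasFDerivAt_fst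
      have h2 : HasFDerivAt (fun x : ℝ × ℝ => x.2 ^ 2)
          ((2 * (0 : ℝ)) • ContinuousLinearMap.snd ℝ ℝ ℝ) (u₀, 0) := by
        simpa using (hasFDerivAt_snd (𝕜 := ℝ) (p := (u₀, (0 : ℝ)))).pow 2
      have h3 : DifferentiableAt ℝ (fun x : ℝ × ℝ => β (x.1, x.2 ^ 2)) (u₀, 0) := by fun_prop
      have h4 := (h1.add (h2.mul h3.hasFDerivAt)).prodMk (hasFDerivAt_snd (𝕜 := ℝ))
      erw [h4.fderiv] at hy
      obtain ⟨y1, y2⟩ := y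
      simp only [ContinuousLinearMap.prod_apply, Prod.mk_eq_zero] at hy
      obtain ⟨e1, e2⟩ := hy
      simp at e1 e2
      simp [hm1] at e1
      simp [e1, e2])
  obtain ⟨ψ, hψ, hψs, hψe⟩ := exists_isCoordChange
    (f := fun X : ℝ × ℝ × ℝ => (m X.1 + (X.2.1 - A X.1) * β (X.1, X.2.1 - A X.1),
      X.2.2 - B X.1 - (X.2.1 - A X.1) * α (X.1, X.2.1 - A X.1), X.2.1 - A X.1))
    (a := (u₀, A u₀, B u₀))
    (by
      have hfst : Tendsto (fun x : ℝ × ℝ × ℝ => x.1) (𝓝 (u₀, A u₀, B u₀)) (𝓝 u₀) :=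
        continuousAt_fst
      filter_upwards [hfst.eventually hm, hfst.eventually hA, hfst.eventually hB] with x hx hx1 hx2
      have h1 : ContDiffAt ℝ ∞ (fun x : ℝ × ℝ × ℝ => m x.1) x := hx.comp x contDiffAt_fst
      have h2 : ContDiffAt ℝ ∞ (fun x : ℝ × ℝ × ℝ => A x.1) x := hx1.comp x contDiffAt_fst
      have h3 : ContDiffAt ℝ ∞ (fun x : ℝ × ℝ × ℝ => B x.1) x := hx2.comp x contDiffAt_fst
      have h4 : ContDiffAt ℝ ∞ (fun x : ℝ × ℝ × ℝ => x.2.1 - A x.1) x :=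
        contDiffAt_snd.fst.sub h2
      have h5 : ContDiffAt ℝ ∞ (fun x : ℝ × ℝ × ℝ => β (x.1, x.2.1 - A x.1)) x :=
        hβ.contDiffAt.comp x (contDiffAt_fst.prodMk h4)
      have h6 : ContDiffAt ℝ ∞ (fun x : ℝ × ℝ × ℝ => α (x.1, x.2.1 - A x.1)) x :=
        hα.contDiffAt.comp x (contDiffAt_fst.prodMk h4)
      exact (h1.add (h4.mul h5)).prodMk (((contDiffAt_snd.snd.sub h3).sub (h4.mul h6)).prodMk h4))
    (by
      intro y hy
      set q : ℝ × ℝ × ℝ := (u₀, A u₀, B u₀)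
      have h1 : HasFDerivAt (fun x : ℝ × ℝ × ℝ => m x.1)
          (deriv m u₀ • ContinuousLinearMap.fst ℝ ℝ (ℝ × ℝ)) q :=
        hmd.comp_hasFDerivAt q hasFDerivAt_fst
      have h2 : HasFDerivAt (fun x : ℝ × ℝ × ℝ => A x.1)
          (deriv A u₀ • ContinuousLinearMap.fst ℝ ℝ (ℝ × ℝ)) q :=
        hAd.comp_hasFDerivAt q hasFDerivAt_fst
      have h3 : HasFDerivAt (fun x : ℝ × ℝ × ℝ => B x.1)
          (deriv B u₀ • ContinuousLinearMap.fst ℝ ℝ (ℝ × ℝ)) q :=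
        hBd.comp_hasFDerivAt q hasFDerivAt_fst
      have h4 : HasFDerivAt (fun x : ℝ × ℝ × ℝ => x.2.1 - A x.1) _ q :=
        (hasFDerivAt_snd (𝕜 := ℝ)).fst.sub h2
      have h5 : DifferentiableAt ℝ (fun x : ℝ × ℝ × ℝ => β (x.1, x.2.1 - A x.1)) q :=
        (hβd _).comp q (differentiableAt_fst.prodMk h4.differentiableAt)
      have h6 : DifferentiableAt ℝ (fun x : ℝ × ℝ × ℝ => α (x.1, x.2.1 - A x.1)) q :=
        (hαd _).comp q (differentiableAt_fst.prodMk h4.differentiableAt)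
      have h7 := (h1.add (h4.mul h5.hasFDerivAt)).prodMk
        ((((hasFDerivAt_snd (𝕜 := ℝ)).snd.sub h3).sub (h4.mul h6.hasFDerivAt)).prodMk h4)
      erw [h7.fderiv] at hy
      obtain ⟨y1, y2, y3⟩ := y
      simp only [ContinuousLinearMap.prod_apply, Prod.mk_eq_zero] at hy
      obtain ⟨e1, e2, e3⟩ := hy
      simp [q] at e1 e2 e3
      -- The differential of the third component vanishes on `y`, so only `m'(u₀) y₁ = 0` remains of
      -- the first; the other coordinates follow in turn.
      simp [e3, hm1] at e1
      subst e1
      simp at e3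
      subst e3
      simp at e2
      simp [e2])
  have hf0 : f (u₀, 0) = (u₀, A u₀, B u₀) := by simp [hf]
  refine ⟨φ, ψ, hφ, hψ, hφs, by simp [hφe, hm0], ?_⟩
  have hfc : ContinuousAt f (u₀, 0) := by
    have hfst : ContinuousAt (fun x : ℝ × ℝ => x.1) (u₀, 0) := continuousAt_fst
    have h1 : ContinuousAt (fun x : ℝ × ℝ => A x.1) (u₀, 0) :=
      hAd.continuousAt.comp_of_eq hfst rfl
    have h2 : ContinuousAt (fun x : ℝ × ℝ => B x.1) (u₀, 0) :=
      hBd.continuousAt.comp_of_eq hfst rfl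
    have h3 : ContinuousAt (fun x : ℝ × ℝ => m x.1) (u₀, 0) :=
      hmd.continuousAt.comp_of_eq hfst rfl
    have h4 : ContinuousAt k (u₀, 0) := hk.self_of_nhds.continuousAt
    have h5 : ContinuousAt (fun x : ℝ × ℝ => x.2) (u₀, 0) := continuousAt_snd
    rw [show f = _ from funext hf]
    exact hfst.prodMk ((h1.add (h5.pow 2)).prodMk
      ((h2.add ((h5.pow 2).mul h4)).add (h5.mul h3)))
  have hs : ∀ᶠ x in 𝓝 (u₀, (0 : ℝ)), f x ∈ ψ.source :=
    hfc.eventually (by rw [hf0]; exact ψ.open_source.mem_nhds hψs)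
  filter_upwards [hs, hαβ] with x hx hkx
  refine ⟨hx, ?_⟩
  simp only [hψe, hφe, hf, add_sub_cancel_left, hkx, Prod.mk.injEq, true_and, and_true]
  ring

end WhitneyUmbrella

/-! ### The singular locus -/

section SingularPoints

/-- The first component forces any kernel vector to be a multiple of `(0, 1)`. -/
theorem isSingularPoint_iff {f : ℝ × ℝ → ℝ × ℝ × ℝ} {p q : ℝ × ℝ → ℝ} {u v p' q' : ℝ}
    (hf : ∀ x, f x = (x.1, p x, q x))
    (hp : DifferentiableAt ℝ p (u, v)) (hq : DifferentiableAt ℝ q (u, v))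
    (hp' : HasDerivAt (fun y => p (u, y)) p' v) (hq' : HasDerivAt (fun y => q (u, y)) q' v) :
    IsSingularPoint f (u, v) ↔ p' = 0 ∧ q' = 0 := by
  have hline : HasDerivAt (fun y : ℝ => (u, y)) ((0 : ℝ), (1 : ℝ)) v :=
    (hasDerivAt_const v u).prodMk (hasDerivAt_id v)
  have hpe : fderiv ℝ p (u, v) (0, 1) = p' :=
    (HasFDerivAt.comp_hasDerivAt (f := fun y : ℝ => (u, y)) v hp.hasFDerivAt hline).unique hp'
  have hqe : fderiv ℝ q (u, v) (0, 1) = q' :=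
    (HasFDerivAt.comp_hasDerivAt (f := fun y : ℝ => (u, y)) v hq.hasFDerivAt hline).unique hq'
  have hd : HasFDerivAt f ((ContinuousLinearMap.fst ℝ ℝ ℝ).prod
      ((fderiv ℝ p (u, v)).prod (fderiv ℝ q (u, v)))) (u, v) := by
    rw [show f = _ from funext hf]
    exact hasFDerivAt_fst.prodMk (hp.hasFDerivAt.prodMk hq.hasFDerivAt)
  rw [IsSingularPoint, hd.fderiv, not_iff_comm, injective_iff_map_eq_zero]
  constructor
  · rintro hne ⟨a, b⟩ hab
    simp only [ContinuousLinearMap.prod_apply, ContinuousLinearMap.coe_fst', Prod.mk_eq_zero] at hab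
    obtain ⟨rfl, h1, h2⟩ := hab
    have e : ((0, b) : ℝ × ℝ) = b • (0, 1) := by simp
    rw [e, map_smul, smul_eq_mul] at h1 h2
    rw [hpe] at h1
    rw [hqe] at h2
    by_contra hb
    have hb' : b ≠ 0 := fun h => hb (by simp [h])
    exact hne ⟨(mul_eq_zero.1 h1).resolve_left hb', (mul_eq_zero.1 h2).resolve_left hb'⟩
  · rintro hinj ⟨rfl, rfl⟩
    have := hinj (0, 1) (by simp [hpe, hqe])
    simp at this

theorem isSingularPoint_normalForm_iff {f21 f31 : ℝ → ℝ} {f24 f33 f34 : ℝ × ℝ → ℝ}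
    {f32 : ℝ × ℝ × ℝ → ℝ} {s u v : ℝ} (h21 : DifferentiableAt ℝ f21 u)
    (h31 : DifferentiableAt ℝ f31 u) (h24 : DifferentiableAt ℝ f24 (u, s))
    (h33 : DifferentiableAt ℝ f33 (u, s)) (h34 : DifferentiableAt ℝ f34 (u, s))
    (h32 : DifferentiableAt ℝ f32 (u, v, s)) :
    IsSingularPoint (normalForm f21 f31 f24 f33 f34 f32 s) (u, v) ↔ v = 0 ∧ f33 (u, s) = 0 := by
  have hfst : DifferentiableAt ℝ (fun x : ℝ × ℝ => x.1) (u, v) := differentiableAt_fst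
  have hsnd : DifferentiableAt ℝ (fun x : ℝ × ℝ => x.2) (u, v) := differentiableAt_snd
  have e21 : DifferentiableAt ℝ (fun x : ℝ × ℝ => f21 x.1) (u, v) := h21.comp (u, v) hfst
  have e31 : DifferentiableAt ℝ (fun x : ℝ × ℝ => f31 x.1) (u, v) := h31.comp (u, v) hfst
  have hus : DifferentiableAt ℝ (fun x : ℝ × ℝ => (x.1, s)) (u, v) := by fun_prop
  have e24 : DifferentiableAt ℝ (fun x : ℝ × ℝ => f24 (x.1, s)) (u, v) := h24.comp (u, v) hus
  have e33 : DifferentiableAt ℝ (fun x : ℝ × ℝ => f33 (x.1, s)) (u, v) := h33.comp (u, v) hus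
  have e34 : DifferentiableAt ℝ (fun x : ℝ × ℝ => f34 (x.1, s)) (u, v) := h34.comp (u, v) hus
  have huvs : DifferentiableAt ℝ (fun x : ℝ × ℝ => (x.1, x.2, s)) (u, v) := by fun_prop
  have e32 : DifferentiableAt ℝ (fun x : ℝ × ℝ => f32 (x.1, x.2, s)) (u, v) := h32.comp (u, v) huvs
  have hl : DifferentiableAt ℝ (fun y : ℝ => (u, y, s)) v := by fun_prop
  have d32 : DifferentiableAt ℝ (fun y : ℝ => f32 (u, y, s)) v :=
    DifferentiableAt.comp (f := fun y : ℝ => (u, y, s)) v h32 hl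
  have hsq : HasDerivAt (fun y : ℝ => y ^ 2) (2 * v) v := by simpa using hasDerivAt_pow 2 v
  have hp' : HasDerivAt (fun y : ℝ => u ^ 2 * f21 u + y ^ 2 + u * s * f24 (u, s)) (2 * v) v :=
    (hsq.const_add _).add_const _
  have hq' : HasDerivAt (fun y : ℝ => u ^ 2 * f31 u + y ^ 2 * f32 (u, y, s) + y * f33 (u, s)
      + u * s * f34 (u, s)) (2 * v * f32 (u, v, s) + v ^ 2 * deriv (fun y => f32 (u, y, s)) v
        + 1 * f33 (u, s)) v :=
    (((hsq.mul d32.hasDerivAt).const_add _).add ((hasDerivAt_id v).mul_const _)).add_const _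
  rw [isSingularPoint_iff (f := normalForm f21 f31 f24 f33 f34 f32 s)
    (p := fun x => x.1 ^ 2 * f21 x.1 + x.2 ^ 2 + x.1 * s * f24 (x.1, s))
    (q := fun x => x.1 ^ 2 * f31 x.1 + x.2 ^ 2 * f32 (x.1, x.2, s) + x.2 * f33 (x.1, s)
      + x.1 * s * f34 (x.1, s)) (fun x => rfl)
    ((((hfst.pow 2).mul e21).add (hsnd.pow 2)).add ((hfst.mul_const s).mul e24))
    (((((hfst.pow 2).mul e31).add ((hsnd.pow 2).mul e32)).add (hsnd.mul e33)).add
      ((hfst.mul_const s).mul e34)) hp' hq']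
  constructor
  · rintro ⟨h1, h2⟩
    have hv : v = 0 := by linarith
    subst hv
    simpa using h2
  · rintro ⟨rfl, h2⟩
    simp [h2]

end SingularPoints

/-! ### Factorization of `f₃₃` and Taylor remainders -/

section Expansion

variable {f33 : ℝ × ℝ → ℝ} {c1 c2 c3 : ℝ → ℝ} {c4 : ℝ × ℝ → ℝ} {c20 : ℝ}

/-- After the substitution `s = -t²`, the function `f₃₃` is a difference of two squares. -/
theorem IsExpansion.exists_sq_sub_sq (hc : IsExpansion f33 c1 c2 c3 c4) (hc2 : 0 < c2 0)
    (hc20 : c2 0 = c20 ^ 2) : ∃ a b : ℝ × ℝ → ℝ, SmoothGerm a ∧ SmoothGerm b ∧ a 0 = c20 ∧ b 0 = 1 ∧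
      (∀ x t, a (x, -t) = a (x, t)) ∧ (∀ x t, b (x, -t) = b (x, t)) ∧
      ∀ᶠ z in 𝓝 (0 : ℝ × ℝ), f33 (z.1, -z.2 ^ 2) = (z.1 * a z) ^ 2 - (z.2 * b z) ^ 2 := by
  have hc20' : c20 ≠ 0 := by
    rintro rfl
    simp [hc20] at hc2
  -- Here `f₃₃(x, -t²) = x² c₂₀² g - t² e` with `g(0) = e(0) = 1`, so both have smooth square roots.
  -- Taking `c₂₀` out of the root gives `a(0) = c₂₀` whatever its sign.
  set g : ℝ × ℝ → ℝ := fun z =>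
    (c2 (-z.2 ^ 2) + z.1 * c3 (-z.2 ^ 2) + z.1 ^ 2 * c4 (z.1, -z.2 ^ 2)) / c20 ^ 2 with hg
  set e : ℝ × ℝ → ℝ := fun z => 1 + z.1 * c1 (-z.2 ^ 2) with he
  have hN : ContDiff ℝ ∞ fun z : ℝ × ℝ => -z.2 ^ 2 := by fun_prop
  have hN0 : Tendsto (fun z : ℝ × ℝ => -z.2 ^ 2) (𝓝 0) (𝓝 0) := by
    simpa using hN.continuous.tendsto 0
  have hM : ContDiff ℝ ∞ fun z : ℝ × ℝ => (z.1, -z.2 ^ 2) := by fun_prop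
  have hM0 : Tendsto (fun z : ℝ × ℝ => (z.1, -z.2 ^ 2)) (𝓝 0) (𝓝 0) := by
    simpa [← Prod.mk_zero_zero] using hM.continuous.tendsto 0
  have hfst : ∀ z : ℝ × ℝ, ContDiffAt ℝ ∞ (fun z : ℝ × ℝ => z.1) z := fun z => contDiffAt_fst
  have hgs : SmoothGerm g := by
    filter_upwards [hN0.eventually hc.smooth2, hN0.eventually hc.smooth3,
      hM0.eventually hc.smooth4] with z h2 h3 h4
    have e2 : ContDiffAt ℝ ∞ (fun z : ℝ × ℝ => c2 (-z.2 ^ 2)) z := h2.comp z hN.contDiffAt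
    have e3 : ContDiffAt ℝ ∞ (fun z : ℝ × ℝ => c3 (-z.2 ^ 2)) z := h3.comp z hN.contDiffAt
    have e4 : ContDiffAt ℝ ∞ (fun z : ℝ × ℝ => c4 (z.1, -z.2 ^ 2)) z := h4.comp z hM.contDiffAt
    exact ((e2.add ((hfst z).mul e3)).add (((hfst z).pow 2).mul e4)).div_const _
  have hes : SmoothGerm e := by
    filter_upwards [hN0.eventually hc.smooth1] with z h1
    have e1 : ContDiffAt ℝ ∞ (fun z : ℝ × ℝ => c1 (-z.2 ^ 2)) z := h1.comp z hN.contDiffAt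
    exact contDiffAt_const.add ((hfst z).mul e1)
  have hg0 : g 0 = 1 := by simp [hg, hc20, hc20']
  have he0 : e 0 = 1 := by simp [he]
  have hgpos : ∀ᶠ z in 𝓝 (0 : ℝ × ℝ), 0 < g z :=
    hgs.self_of_nhds.continuousAt.eventually (lt_mem_nhds (by simp [hg0]))
  have hepos : ∀ᶠ z in 𝓝 (0 : ℝ × ℝ), 0 < e z :=
    hes.self_of_nhds.continuousAt.eventually (lt_mem_nhds (by simp [he0]))
  refine ⟨fun z => c20 * √(g z), fun z => √(e z), ?_, ?_, by simp [hg0], by simp [he0],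
    fun x t => by simp [hg], fun x t => by simp [he], ?_⟩
  · filter_upwards [hgs, hgpos] with z h1 h2
    exact contDiffAt_const.mul (h1.sqrt h2.ne')
  · filter_upwards [hes, hepos] with z h1 h2
    exact h1.sqrt h2.ne'
  · filter_upwards [hM0.eventually hc.eq, hgpos, hepos] with z h1 h2 h3
    have e1 : (z.1 * (c20 * √(g z))) ^ 2 = z.1 ^ 2 * (c20 ^ 2 * g z) := by
      rw [mul_pow, mul_pow, Real.sq_sqrt h2.le]
    rw [h1, e1, mul_pow, Real.sq_sqrt h3.le]
    simp only [hg, he]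
    field_simp
    ring

/-- The quadratic Taylor remainder of a smooth germ on the line. -/
theorem SmoothGerm.isBigO_sub_linear {c : ℝ → ℝ} (hc : SmoothGerm c) :
    (fun s => c s - c 0 - deriv c 0 * s) =O[𝓝 0] fun s => s ^ 2 := by
  have hd : DifferentiableAt ℝ (deriv c) 0 := by
    have h1 : ContDiffAt ℝ ∞ (fderiv ℝ c) 0 :=
      hc.self_of_nhds.fderiv_right (by simp)
    exact (h1.differentiableAt (by simp)).clm_apply (differentiableAt_const (1 : ℝ))
  obtain ⟨K, hK0, hK⟩ := hd.isBigO_sub.exists_nonneg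
  obtain ⟨r, hr, hball⟩ := Metric.eventually_nhds_iff_ball.1 (hK.bound.and hc)
  refine IsBigO.of_bound K ?_
  filter_upwards [Metric.ball_mem_nhds (0 : ℝ) hr] with s hs
  rw [mem_ball_zero_iff] at hs
  have hsub : ∀ y ∈ Metric.closedBall (0 : ℝ) |s|, y ∈ Metric.ball (0 : ℝ) r := fun y hy => by
    rw [mem_closedBall_zero_iff] at hy
    rw [mem_ball_zero_iff]
    exact hy.trans_lt hs
  -- Mean value inequality: the remainder has derivative `c'(y) - c'(0)`, at most `K |s|` on this
  -- ball.
  have key := (convex_closedBall (0 : ℝ) |s|).norm_image_sub_le_of_norm_hasDerivWithin_le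
    (f := fun s => c s - c 0 - deriv c 0 * s) (f' := fun y => deriv c y - deriv c 0)
    (C := K * |s|) (x := 0) (y := s)
    (fun y hy => by
      have h1 := ((hball y (hsub y hy)).2.differentiableAt (by simp)).hasDerivAt
      have h2 := (h1.sub_const (c 0)).sub ((hasDerivAt_id y).const_mul (deriv c 0))
      rw [mul_one] at h2
      exact h2.hasDerivWithinAt)
    (fun y hy => by
      have h1 := (hball y (hsub y hy)).1
      rw [sub_zero] at h1
      rw [mem_closedBall_zero_iff] at hy
      exact h1.trans (by gcongr))
    (by simp) (by simp)
  simpa [sq, mul_assoc] using key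

end Expansion

/-! ### The third-order expansion of the root -/

section Asymptotics

variable {f33 : ℝ × ℝ → ℝ} {c1 c2 c3 : ℝ → ℝ} {c4 : ℝ × ℝ → ℝ}

/-- Substituting a cubic polynomial in `t` for `u` in `f₃₃(u, -t²)` leaves a residual of order
`t⁵` if the coefficients of `t²`, `t³`, `t⁴` in the result vanish. -/
theorem IsExpansion.isBigO_residual (hc : IsExpansion f33 c1 c2 c3 c4) {q0 q1 q2 : ℝ}
    (k0 : q0 ^ 2 * c2 0 = 1)
    (k1 : -q0 * c1 0 + 2 * q0 * q1 * c2 0 + q0 ^ 3 * c3 0 = 0)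
    (k2 : -q1 * c1 0 + (q1 ^ 2 + 2 * q0 * q2) * c2 0 - q0 ^ 2 * deriv c2 0
      + 3 * q0 ^ 2 * q1 * c3 0 + q0 ^ 4 * c4 0 = 0) :
    (fun t : ℝ => f33 (t * (q0 + q1 * t + q2 * t ^ 2), -t ^ 2)) =O[𝓝 0] fun t => t ^ 5 := by
  set Q : ℝ → ℝ := fun t => q0 + q1 * t + q2 * t ^ 2 with hQ
  have hQc : Continuous Q := by fun_prop
  have hQO : Q =O[𝓝 0] fun _ => (1 : ℝ) := hQc.continuousAt.isBigO_one ℝ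
  have hid : (fun t : ℝ => t) =O[𝓝 0] fun t => t := isBigO_refl _ _
  have hPO : (fun t => t * Q t) =O[𝓝 0] fun t => t := by simpa using hid.mul hQO
  have hN : Tendsto (fun t : ℝ => -t ^ 2) (𝓝 0) (𝓝 0) := by
    simpa using (by fun_prop : Continuous fun t : ℝ => -t ^ 2).tendsto 0
  have hP : Tendsto (fun t : ℝ => (t * Q t, -t ^ 2)) (𝓝 0) (𝓝 0) := by
    simpa [← Prod.mk_zero_zero] using
      (by fun_prop : Continuous fun t : ℝ => (t * Q t, -t ^ 2)).tendsto 0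
  have hsq : (fun t : ℝ => -t ^ 2) =O[𝓝 0] fun t => t ^ 2 := (isBigO_refl _ _).neg_left
  have hlin : ∀ {c : ℝ → ℝ}, SmoothGerm c →
      (fun t : ℝ => c (-t ^ 2) - c 0) =O[𝓝 0] fun t => t ^ 2 := fun {c} h => by
    have h1 := (h.self_of_nhds.differentiableAt (by simp)).isBigO_sub.comp_tendsto hN
    simp only [Function.comp_def, sub_zero] at h1
    exact h1.trans hsq
  -- Freezing `c₁`, `c₃`, `c₄` at the origin costs `O(t⁵)`. Only `c₂` needs its linear term, since
  -- `(t Q)² t²` is already of order `t⁴`.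
  have r1 : (fun t => t ^ 2 * (t * Q t) * (c1 (-t ^ 2) - c1 0)) =O[𝓝 0] fun t => t ^ 5 :=
    (((hid.pow 2).mul hPO).mul (hlin hc.smooth1)).congr_right fun t => by ring
  have r2 : (fun t => (t * Q t) ^ 2 * (c2 (-t ^ 2) - c2 0 - deriv c2 0 * -t ^ 2))
      =O[𝓝 0] fun t => t ^ 5 := by
    have h1 := (hc.smooth2.isBigO_sub_linear.comp_tendsto hN).trans (hsq.pow 2)
    refine ((hPO.pow 2).mul h1).trans ?_
    have h2 : (fun t : ℝ => t) =O[𝓝 0] fun _ => (1 : ℝ) := continuousAt_id.isBigO_one ℝ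
    exact (h2.mul (isBigO_refl (fun t : ℝ => t ^ 5) _)).congr (fun t => by ring) fun t => by ring
  have r3 : (fun t => (t * Q t) ^ 3 * (c3 (-t ^ 2) - c3 0)) =O[𝓝 0] fun t => t ^ 5 :=
    ((hPO.pow 3).mul (hlin hc.smooth3)).congr_right fun t => by ring
  have r4 : (fun t => (t * Q t) ^ 4 * (c4 (t * Q t, -t ^ 2) - c4 0)) =O[𝓝 0] fun t => t ^ 5 := by
    have h1 := (hc.smooth4.self_of_nhds.differentiableAt (by simp)).isBigO_sub.comp_tendsto hP
    have h2 : (fun t : ℝ => (t * Q t, -t ^ 2)) =O[𝓝 0] fun t => t := by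
      refine hPO.prod_left (hsq.trans ?_)
      have h3 : (fun t : ℝ => t) =O[𝓝 0] fun _ => (1 : ℝ) := continuousAt_id.isBigO_one ℝ
      exact (h3.mul hid).congr (fun t => by ring) fun t => by ring
    simp only [Function.comp_def, sub_zero] at h1
    exact ((hPO.pow 4).mul (h1.trans h2)).congr_right fun t => by ring
  -- `t⁵ R(t)` is what remains of the polynomial part once its terms in `t²`, `t³`, `t⁴` cancel.
  set R : ℝ → ℝ := fun t => -q2 * c1 0 + (2 * q1 * q2 + q2 ^ 2 * t) * c2 0
    - deriv c2 0 * (2 * q0 * (q1 + q2 * t) + t * (q1 + q2 * t) ^ 2)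
    + c3 0 * (3 * q0 ^ 2 * q2 + 3 * q0 * (q1 + q2 * t) ^ 2 + t * (q1 + q2 * t) ^ 3)
    + c4 0 * (q1 + q2 * t) * (4 * q0 ^ 3 + 6 * q0 ^ 2 * t * (q1 + q2 * t)
      + 4 * q0 * t ^ 2 * (q1 + q2 * t) ^ 2 + t ^ 3 * (q1 + q2 * t) ^ 3) with hR
  have hRc : Continuous R := by fun_prop
  have r5 : (fun t => t ^ 5 * R t) =O[𝓝 0] fun t => t ^ 5 :=
    ((isBigO_refl (fun t : ℝ => t ^ 5) _).mul (hRc.continuousAt.isBigO_one ℝ)).congr_right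
      fun t => by ring
  refine ((((r5.sub r1).add r2).add r3).add r4).congr' ?_ EventuallyEq.rfl
  filter_upwards [hP.eventually hc.eq] with t ht
  rw [ht]
  simp only [hR, hQ]
  linear_combination (-t ^ 2) * k0 - t ^ 3 * k1 - t ^ 4 * k2

/-- The coefficients solve the three equations of `isBigO_residual` successively, starting from the
root `q0 = 1 / c20`. -/
theorem IsExpansion.isBigO_residual_zero (hc : IsExpansion f33 c1 c2 c3 c4) {c20 : ℝ}
    (hc0 : c20 ≠ 0) (hc20 : c2 0 = c20 ^ 2) :
    (fun t : ℝ => f33 (t * (1 / c20 + 1 / (2 * c20 ^ 4) * (c1 0 * c20 ^ 2 - c3 0) * t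
        + 1 / (8 * c20 ^ 7) * ((c1 0 ^ 2 + 4 * deriv c2 0) * c20 ^ 4
            - 2 * (3 * c3 0 * c1 0 + 2 * c4 0) * c20 ^ 2 + 5 * c3 0 ^ 2) * t ^ 2), -t ^ 2))
      =O[𝓝 0] fun t => t ^ 5 := by
  apply hc.isBigO_residual
  · rw [hc20]
    field_simp
  · rw [hc20]
    field_simp
    ring
  · rw [hc20]
    field_simp
    ring

/-- If the residual `(x a)² - (t b)²` at `x = t Q(t)` is of order `t⁵`, then the factor
`x a - t b` is of order `t⁴`. -/
theorem isBigO_factor {F a b : ℝ × ℝ → ℝ} {Q : ℝ → ℝ} (ha : ContinuousAt a 0)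
    (hb : ContinuousAt b 0) (hQ : ContinuousAt Q 0) (hne : Q 0 * a 0 + b 0 ≠ 0)
    (hF : ∀ᶠ z in 𝓝 (0 : ℝ × ℝ), F z = (z.1 * a z) ^ 2 - (z.2 * b z) ^ 2)
    (hO : (fun t => F (t * Q t, t)) =O[𝓝 0] fun t : ℝ => t ^ 5) :
    (fun t => t * Q t * a (t * Q t, t) - t * b (t * Q t, t)) =O[𝓝 0] fun t : ℝ => t ^ 4 := by
  have hP : ContinuousAt (fun t : ℝ => (t * Q t, t)) 0 :=
    (continuousAt_id.mul hQ).prodMk continuousAt_id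
  have hP' : Tendsto (fun t : ℝ => (t * Q t, t)) (𝓝 0) (𝓝 0) := by
    simpa [ContinuousAt, ← Prod.mk_zero_zero] using hP
  have hS : Tendsto (fun t => Q t * a (t * Q t, t) + b (t * Q t, t)) (𝓝 0)
      (𝓝 (Q 0 * a 0 + b 0)) :=
    (hQ.tendsto.mul (ha.tendsto.comp hP')).add (hb.tendsto.comp hP')
  have hinv : (fun t => (Q t * a (t * Q t, t) + b (t * Q t, t))⁻¹) =O[𝓝 0] fun _ => (1 : ℝ) :=
    (hS.inv₀ hne).isBigO_one ℝ
  obtain ⟨K, hK⟩ := (hinv.mul hO).bound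
  refine IsBigO.of_bound K ?_
  filter_upwards [hK, hP'.eventually hF, hS.eventually_ne hne] with t ht hFt hSt
  rcases eq_or_ne t 0 with rfl | h0
  · simp
  · rw [hFt] at ht
    -- The conjugate factor is `t (Q a + b)` with `Q a + b` bounded away from zero, so dividing by
    -- it loses just one power of `t`.
    have e : (Q t * a (t * Q t, t) + b (t * Q t, t))⁻¹ *
        ((t * Q t * a (t * Q t, t)) ^ 2 - (t * b (t * Q t, t)) ^ 2) =
        t * (t * Q t * a (t * Q t, t) - t * b (t * Q t, t)) := by
      rw [inv_mul_eq_iff_eq_mul₀ hSt]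
      ring
    simp only [e, one_mul, norm_mul, norm_pow] at ht ⊢
    have hpos : 0 < ‖t‖ := norm_pos_iff.2 h0
    refine le_of_mul_le_mul_left (ht.trans_eq ?_) hpos
    ring

end Asymptotics

/-! ### Umbrellas in the family, and the main theorem -/

theorem isWhitneyUmbrella_normalForm {f21 f31 : ℝ → ℝ} {f24 f33 f34 : ℝ × ℝ → ℝ}
    {f32 : ℝ × ℝ × ℝ → ℝ} {s u₀ : ℝ} (h21 : ∀ᶠ x in 𝓝 u₀, ContDiffAt ℝ ∞ f21 x)
    (h31 : ∀ᶠ x in 𝓝 u₀, ContDiffAt ℝ ∞ f31 x) (h24 : ∀ᶠ y in 𝓝 (u₀, s), ContDiffAt ℝ ∞ f24 y)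
    (h33 : ∀ᶠ y in 𝓝 (u₀, s), ContDiffAt ℝ ∞ f33 y)
    (h34 : ∀ᶠ y in 𝓝 (u₀, s), ContDiffAt ℝ ∞ f34 y)
    (h32 : ∀ᶠ y in 𝓝 (u₀, (0 : ℝ), s), ContDiffAt ℝ ∞ f32 y)
    (h0 : f33 (u₀, s) = 0) (h1 : deriv (fun x => f33 (x, s)) u₀ ≠ 0) :
    IsWhitneyUmbrella (normalForm f21 f31 f24 f33 f34 f32 s) (u₀, 0) := by
  have hl : ContDiff ℝ ∞ fun x : ℝ => (x, s) := by fun_prop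
  have hlt : Tendsto (fun x : ℝ => (x, s)) (𝓝 u₀) (𝓝 (u₀, s)) := hl.continuous.tendsto u₀
  have hslice : ∀ {g : ℝ × ℝ → ℝ}, (∀ᶠ y in 𝓝 (u₀, s), ContDiffAt ℝ ∞ g y) →
      ∀ᶠ x in 𝓝 u₀, ContDiffAt ℝ ∞ (fun x => g (x, s)) x := fun {g} hg => by
    filter_upwards [hlt.eventually hg] with x hx
    exact ContDiffAt.comp (f := fun x : ℝ => (x, s)) x hx hl.contDiffAt
  have hm : ContDiff ℝ ∞ fun x : ℝ × ℝ => (x.1, x.2, s) := by fun_prop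
  have hmt : Tendsto (fun x : ℝ × ℝ => (x.1, x.2, s)) (𝓝 (u₀, 0)) (𝓝 (u₀, 0, s)) :=
    hm.continuous.tendsto (u₀, 0)
  refine isWhitneyUmbrella_of_normal (A := fun x => x ^ 2 * f21 x + x * s * f24 (x, s))
    (B := fun x => x ^ 2 * f31 x + x * s * f34 (x, s)) (m := fun x => f33 (x, s))
    (k := fun x => f32 (x.1, x.2, s)) ?_ ?_ (hslice h33) ?_ h0 h1 fun x => ?_
  · filter_upwards [h21, hslice h24] with x hx hx'
    exact ((contDiffAt_id.pow 2).mul hx).add ((contDiffAt_id.mul contDiffAt_const).mul hx')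
  · filter_upwards [h31, hslice h34] with x hx hx'
    exact ((contDiffAt_id.pow 2).mul hx).add ((contDiffAt_id.mul contDiffAt_const).mul hx')
  · filter_upwards [hmt.eventually h32] with x hx
    exact ContDiffAt.comp (f := fun x : ℝ × ℝ => (x.1, x.2, s)) x hx hm.contDiffAt
  · simp only [normalForm, Prod.mk.injEq, true_and]
    constructor <;> ring

/-- A product `h(x, t) h(x, -t)` has a simple zero in `x` at a zero of the first factor where the
second factor does not vanish. -/
theorem deriv_mul_neg_ne_zero {h : ℝ × ℝ → ℝ} {m : ℝ → ℝ} {x t : ℝ} (hd : DifferentiableAt ℝ h (x, t))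
    (hd' : DifferentiableAt ℝ h (x, -t)) (hm : ∀ᶠ y in 𝓝 x, m y = h (y, t) * h (y, -t))
    (h0 : h (x, t) = 0) (h1 : fderiv ℝ h (x, t) (1, 0) ≠ 0) (h2 : h (x, -t) ≠ 0) :
    deriv m x ≠ 0 := by
  have hl : ∀ r : ℝ, HasDerivAt (fun y : ℝ => (y, r)) ((1 : ℝ), (0 : ℝ)) x := fun r =>
    (hasDerivAt_id x).prodMk (hasDerivAt_const x r)
  have e1 := HasFDerivAt.comp_hasDerivAt (f := fun y : ℝ => (y, t)) x hd.hasFDerivAt (hl t)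
  have e2 := HasFDerivAt.comp_hasDerivAt (f := fun y : ℝ => (y, -t)) x hd'.hasFDerivAt (hl (-t))
  have e3 : deriv m x = fderiv ℝ h (x, t) (1, 0) * h (x, -t) := by
    rw [EventuallyEq.deriv_eq (f := fun y => h (y, t) * h (y, -t)) hm]
    refine HasDerivAt.deriv ((e1.mul e2).congr_deriv ?_)
    simp [h0]
  rw [e3]
  exact mul_ne_zero h1 h2

end S1Deformation

open S1Deformation in
theorem theorem3p3
    (f21 f31 : ℝ → ℝ) (f24 f33 f34 : ℝ × ℝ → ℝ) (f32 : ℝ × ℝ × ℝ → ℝ)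
    (hf : IsNormalForm f21 f31 f24 f33 f34 f32)
    (c1 c2 c3 : ℝ → ℝ) (c4 : ℝ × ℝ → ℝ) (hc : IsExpansion f33 c1 c2 c3 c4)
    (hc2 : 0 < c2 0) (c20 : ℝ) (hc20 : c2 0 = c20 ^ 2) :
    ∃ u : ℝ → ℝ, SmoothGerm u ∧ u 0 = 0 ∧
      -- near the origin, the singular points of `f^s` with `s = -t²` are `(u (±t), 0)`
      (∀ᶠ z in 𝓝 (0 : ℝ × ℝ × ℝ),
        IsSingularPoint (normalForm f21 f31 f24 f33 f34 f32 (-z.1 ^ 2)) z.2 ↔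
          z.2.2 = 0 ∧ (z.2.1 = u z.1 ∨ z.2.1 = u (-z.1))) ∧
      (fun t : ℝ => u t -
          (1 / c20 * t
            + 1 / (2 * c20 ^ 4) * (c1 0 * c20 ^ 2 - c3 0) * t ^ 2
            + 1 / (8 * c20 ^ 7) * ((c1 0 ^ 2 + 4 * deriv c2 0) * c20 ^ 4
                - 2 * (3 * c3 0 * c1 0 + 2 * c4 (0, 0)) * c20 ^ 2 + 5 * c3 0 ^ 2) * t ^ 3))
        =O[𝓝 0] (fun t : ℝ => t ^ 4) ∧
      (∀ᶠ t in 𝓝[≠] (0 : ℝ),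
        IsWhitneyUmbrella (normalForm f21 f31 f24 f33 f34 f32 (-t ^ 2)) (u t, 0) ∧
        IsWhitneyUmbrella (normalForm f21 f31 f24 f33 f34 f32 (-t ^ 2)) (u (-t), 0)) := by
  have hc0 : c20 ≠ 0 := by
    rintro rfl
    simp [hc20] at hc2
  obtain ⟨a, b, ha, hb, ha0, hb0, ha', hb', hsq⟩ := hc.exists_sq_sub_sq hc2 hc20
  set h : ℝ × ℝ → ℝ := fun z => z.1 * a z - z.2 * b z with hdef
  have hh : SmoothGerm h := by
    filter_upwards [ha, hb] with z h1 h2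
    exact (contDiffAt_fst.mul h1).sub (contDiffAt_snd.mul h2)
  have hh0 : h 0 = 0 := by simp [hdef]
  have hhx : fderiv ℝ h 0 (1, 0) ≠ 0 := by
    have hda := (ha.self_of_nhds.differentiableAt (by simp)).hasFDerivAt
    have hdb := (hb.self_of_nhds.differentiableAt (by simp)).hasFDerivAt
    have hd := ((hasFDerivAt_fst (𝕜 := ℝ)).mul hda).sub ((hasFDerivAt_snd (𝕜 := ℝ)).mul hdb)
    have e : fderiv ℝ h 0 = _ := hd.fderiv
    rw [e]
    simpa [ha0] using hc0
  -- Evenness of `a` and `b` in `t` turns the conjugate factor `x a + t b` into `h(x, -t)`.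
  have hfac : ∀ᶠ z in 𝓝 (0 : ℝ × ℝ), f33 (z.1, -z.2 ^ 2) = h (z.1, z.2) * h (z.1, -z.2) := by
    filter_upwards [hsq] with z hz
    rw [hz]
    simp only [hdef, ha', hb']
    ring
  obtain ⟨u, hu, hu0, hiff, C, hC⟩ := exists_implicit_function hh hh0 hhx
  have hneg : Tendsto (fun z : ℝ × ℝ => (z.1, -z.2)) (𝓝 0) (𝓝 0) := by
    simpa [← Prod.mk_zero_zero] using
      (by fun_prop : Continuous fun z : ℝ × ℝ => (z.1, -z.2)).tendsto 0
  have hsub : Tendsto (fun z : ℝ × ℝ => (z.1, -z.2 ^ 2)) (𝓝 0) (𝓝 0) := by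
    simpa [← Prod.mk_zero_zero] using
      (by fun_prop : Continuous fun z : ℝ × ℝ => (z.1, -z.2 ^ 2)).tendsto 0
  have hfst : Tendsto (fun z : ℝ × ℝ => z.1) (𝓝 0) (𝓝 0) := continuous_fst.tendsto 0
  have hut : Tendsto (fun t : ℝ => (u t, t)) (𝓝 0) (𝓝 0) := by
    have := hu.self_of_nhds.continuousAt.prodMk (continuousAt_id (x := (0 : ℝ)))
    simpa [ContinuousAt, hu0, ← Prod.mk_zero_zero] using this
  refine ⟨u, hu, hu0, ?_, ?_, ?_⟩
  · have hswap : Tendsto (fun z : ℝ × ℝ × ℝ => (z.2.1, z.1)) (𝓝 0) (𝓝 0) := by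
      simpa [← Prod.mk_zero_zero] using
        (by fun_prop : Continuous fun z : ℝ × ℝ × ℝ => (z.2.1, z.1)).tendsto 0
    have h3 : Tendsto (fun z : ℝ × ℝ × ℝ => (z.2.1, z.2.2, -z.1 ^ 2)) (𝓝 0) (𝓝 0) := by
      simpa [← Prod.mk_zero_zero] using
        (by fun_prop : Continuous fun z : ℝ × ℝ × ℝ => (z.2.1, z.2.2, -z.1 ^ 2)).tendsto 0
    have d2 := hsub.comp hswap
    have d1 := hfst.comp hswap
    filter_upwards [d1.eventually hf.smooth21, d1.eventually hf.smooth31, d2.eventually hf.smooth24,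
      d2.eventually hf.smooth33, d2.eventually hf.smooth34, h3.eventually hf.smooth32,
      hswap.eventually hfac, hswap.eventually hiff, (hneg.comp hswap).eventually hiff]
      with ⟨t, x, v⟩ s21 s31 s24 s33 s34 s32 e1 e2 e3
    have key := isSingularPoint_normalForm_iff (s := -t ^ 2) (u := x) (v := v)
      (s21.differentiableAt (by simp)) (s31.differentiableAt (by simp))
      (s24.differentiableAt (by simp)) (s33.differentiableAt (by simp))
      (s34.differentiableAt (by simp)) (s32.differentiableAt (by simp))
    refine key.trans (and_congr_right fun _ => ?_)
    simp only [Function.comp] at e1 e2 e3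
    rw [e1, mul_eq_zero, e2, e3]
  · have hres := hc.isBigO_residual_zero hc0 hc20
    set Q : ℝ → ℝ := fun t => 1 / c20 + 1 / (2 * c20 ^ 4) * (c1 0 * c20 ^ 2 - c3 0) * t
        + 1 / (8 * c20 ^ 7) * ((c1 0 ^ 2 + 4 * deriv c2 0) * c20 ^ 4
            - 2 * (3 * c3 0 * c1 0 + 2 * c4 0) * c20 ^ 2 + 5 * c3 0 ^ 2) * t ^ 2 with hQ
    have hQc : Continuous Q := by fun_prop
    -- The nonvanishing quantity is `Q(0) a(0) + b(0) = 2`.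
    have hO := isBigO_factor (F := fun z => f33 (z.1, -z.2 ^ 2)) (Q := Q)
      ha.self_of_nhds.continuousAt hb.self_of_nhds.continuousAt hQc.continuousAt
      (by simp [hQ, ha0, hb0, hc0]) hsq hres
    have hP : Tendsto (fun t : ℝ => (t * Q t, t)) (𝓝 0) (𝓝 0) := by
      simpa [← Prod.mk_zero_zero] using
        (by fun_prop : Continuous fun t : ℝ => (t * Q t, t)).tendsto 0
    refine (IsBigO.of_bound C ?_).trans hO
    filter_upwards [hP.eventually hC] with t ht
    rw [Real.norm_eq_abs, Real.norm_eq_abs, abs_sub_comm]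
    refine Eq.trans_le ?_ ht
    congr 2
    simp only [hQ, Prod.mk_zero_zero]
    ring
  · have hfx : ∀ᶠ z in 𝓝 (0 : ℝ × ℝ), fderiv ℝ h z (1, 0) ≠ 0 := by
      have hcont : ContinuousAt (fun z => fderiv ℝ h z (1, 0)) 0 :=
        (hh.self_of_nhds.fderiv_right (m := 0) (by simp)).continuousAt.clm_apply continuousAt_const
      exact hcont.eventually_ne hhx
    have hbne : ∀ᶠ z in 𝓝 (0 : ℝ × ℝ), b z ≠ 0 :=
      hb.self_of_nhds.continuousAt.eventually_ne (by simp [hb0])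
    have h3 : Tendsto (fun z : ℝ × ℝ => (z.1, (0 : ℝ), -z.2 ^ 2)) (𝓝 0) (𝓝 0) := by
      simpa [← Prod.mk_zero_zero] using
        (by fun_prop : Continuous fun z : ℝ × ℝ => (z.1, (0 : ℝ), -z.2 ^ 2)).tendsto 0
    have key : ∀ᶠ t in 𝓝[≠] (0 : ℝ),
        IsWhitneyUmbrella (normalForm f21 f31 f24 f33 f34 f32 (-t ^ 2)) (u t, 0) := by
      have d1 := hfst.comp hut
      have d2 := hsub.comp hut
      rw [eventually_nhdsWithin_iff]
      filter_upwards [d1.eventually hf.smooth21.eventually_nhds,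
        d1.eventually hf.smooth31.eventually_nhds, d2.eventually hf.smooth24.eventually_nhds,
        d2.eventually hf.smooth33.eventually_nhds, d2.eventually hf.smooth34.eventually_nhds,
        (h3.comp hut).eventually hf.smooth32.eventually_nhds,
        hut.eventually hfac.eventually_nhds, hut.eventually hiff, hut.eventually hh,
        (hneg.comp hut).eventually hh, hut.eventually hfx, hut.eventually hbne]
        with t s21 s31 s24 s33 s34 s32 e1 e2 e3 e4 e5 e6 ht
      have hz : h (u t, t) = 0 := e2.2 rfl
      have hl : Tendsto (fun y : ℝ => (y, t)) (𝓝 (u t)) (𝓝 (u t, t)) :=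
        (by fun_prop : Continuous fun y : ℝ => (y, t)).tendsto (u t)
      refine isWhitneyUmbrella_normalForm s21 s31 s24 s33 s34 s32 ?_ ?_
      · rw [e1.self_of_nhds, hz, zero_mul]
      · refine deriv_mul_neg_ne_zero (h := h) (t := t) (e3.differentiableAt (by simp))
          (e4.differentiableAt (by simp)) (hl.eventually e1) hz e5 ?_
        -- This is where `t ≠ 0` enters: at `t = 0` the two roots merge and the zero is double.
        have e7 : h (u t, -t) = h (u t, t) + 2 * t * b (u t, t) := by
          simp only [hdef, ha', hb']
          ring
        rw [e7, hz, zero_add]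
        exact mul_ne_zero (mul_ne_zero two_ne_zero ht) e6
    -- The second singular point is the first one for `-t`, which gives the same `s`.
    have hnegt : Tendsto (fun t : ℝ => -t) (𝓝[≠] 0) (𝓝[≠] 0) := by
      refine tendsto_nhdsWithin_iff.2 ⟨?_, ?_⟩
      · simpa using (continuous_neg.tendsto (0 : ℝ)).mono_left nhdsWithin_le_nhds
      · filter_upwards [self_mem_nhdsWithin] with t ht
        simpa using ht
    filter_upwards [key, hnegt.eventually key] with t h1 h2
    exact ⟨h1, by simpa using h2⟩
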